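/- Let $M$ be a connected Riemann surface with complex structure $I$, and let $\omega=(\omega_1,\omega_2,\omega_3)$ be a holomorphic Weierstrass representation of $M$, that is, a nowhere vanishing triple of holomorphic $1$-forms on $M$ with $\omega_1^2+\omega_2^2+\omega_3^2=0$. The real part $\operatorname{Re}\omega$ is then a closed $\mathbb{R}^3$-valued $1$-form. Let $\pi\colon M_{\operatorname{Re}\omega}\to M$ be the connected covering, with the lifted complex structure, that corresponds to the kernel of the period homomorphism $\pi_1(M,p_0)\to\mathbb{R}^3$, $[\gamma]\mapsto\int_\gamma\operatorname{Re}\omega$ ($\gamma$ piecewise smooth), i.e. such that $\pi_*\pi_1(M_{\operatorname{Re}\omega},\tilde p)$ is this kernel, with $p_0=\pi(\tilde p)$, for every $\tilde p\in M_{\operatorname{Re}\omega}$. Such a covering exists. For a conformal immersion $\varphi$ of a Riemann surface into $\mathbb{R}^3$, its Weierstrass representation is $2\partial\varphi=d\varphi-i\,I^*d\varphi$; call $\varphi$ minimal if its mean curvature vanishes identically. Then: 1. There exists a minimal conformal immersion $\varphi\colon M_{\operatorname{Re}\omega}\to\mathbb{R}^3$ whose Weierstrass representation is $\pi^*\omega$.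 2. Any two such immersions differ by a translation of $\mathbb{R}^3$. 3. The following are equivalent: (a) $\omega$ is the Weierstrass representation of a minimal conformal immersion $M\to\mathbb{R}^3$ of $M$ itself; (b) $\pi\colon M_{\operatorname{Re}\omega}\to M$ is a biholomorphism; (c) all periods of $\omega$, i.e. all integrals $\int_\gamma\omega\in\mathbb{C}^3$ along piecewise smooth loops $\gamma$ in $M$, are purely imaginary (have components in $i\mathbb{R}$). -/

import Mathlib

open scoped Manifold ContDiff Topology

universe u v

noncomputable section

/-- Euclidean three-space. -/
abbrev R3 : Type := EuclideanSpace ℝ (Fin 3)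

/-- Complex three-space. -/
abbrev C3 : Type := EuclideanSpace ℂ (Fin 3)

/-- The componentwise real part `ℂ³ → ℝ³`. -/
def reC3 : C3 →L[ℝ] R3 :=
  LinearMap.toContinuousLinearMap
    { toFun := fun z => WithLp.toLp 2 fun i => (z i).re
      map_add' := fun x y => by ext i; simp
      map_smul' := fun c x => by ext i; simp }

/-- For a real-linear map `L : ℂ → ℝ³`, the complex-linear map `v ↦ L v - i L (i v)`. -/
def complexLinearPart (L : ℂ →L[ℝ] R3) : ℂ →L[ℂ] C3 :=
  LinearMap.toContinuousLinearMap
    { toFun := fun v => WithLp.toLp 2 fun i =>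
        ((L v i : ℝ) : ℂ) - Complex.I * ((L (Complex.I * v) i : ℝ) : ℂ)
      map_add' := fun x y => by
        ext i
        simp [mul_add]
        ring
      map_smul' := fun c x => by
        have h1 : c * x = c.re • x + c.im • (Complex.I * x) := by
          conv_lhs => rw [← Complex.re_add_im c]
          simp only [Complex.real_smul]
          ring
        have h2 : Complex.I * (c * x) = c.re • (Complex.I * x) - c.im • x := by
          conv_lhs => rw [← Complex.re_add_im c]
          simp only [Complex.real_smul]
          linear_combination (c.im : ℂ) * x * Complex.I_mul_I
        ext i
        simp only [smul_eq_mul, h2, RingHom.id_apply, PiLp.smul_apply]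
        rw [h1]
        simp only [map_add, map_sub, map_smul, PiLp.add_apply, PiLp.sub_apply, PiLp.smul_apply,
          smul_eq_mul]
        push_cast
        conv_rhs => rw [← Complex.re_add_im c]
        linear_combination
          ((c.im : ℂ) * ((L (Complex.I * x) i : ℝ) : ℂ)) * Complex.I_mul_I }

section Forms

variable (M : Type*) [TopologicalSpace M] [ChartedSpace ℂ M]

/-- `ℂ³`-valued forms of type `(1,0)` on the complex one-dimensional manifold `M`: families of
complex-linear maps on the tangent spaces. -/
abbrev Form10 : Type _ := ∀ p : M, TangentSpace 𝓘(ℂ, ℂ) p →L[ℂ] C3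

/-- `V`-valued real one-forms on `M`, regarded as a real two-dimensional manifold. -/
abbrev RealForm (V : Type*) [NormedAddCommGroup V] [NormedSpace ℝ V] : Type _ :=
  ∀ p : M, TangentSpace 𝓘(ℝ, ℂ) p →L[ℝ] V

variable {M}

/-- A `(1,0)`-form seen as a `ℂ³`-valued real one-form. -/
def Form10.toReal (α : Form10 M) : RealForm M C3 := fun p =>
  (show ℂ →L[ℂ] C3 from α p).restrictScalars ℝ

/-- The real part of a `(1,0)`-form. -/
def Form10.re (α : Form10 M) : RealForm M R3 := fun p => reC3.comp (α.toReal p)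

/-- The pullback of a `(1,0)`-form under a map of complex one-dimensional manifolds. -/
def Form10.pullback {E : Type*} [TopologicalSpace E] [ChartedSpace ℂ E] (f : E → M)
    (α : Form10 M) : Form10 E :=
  fun e => (α (f e)).comp (mfderiv 𝓘(ℂ, ℂ) 𝓘(ℂ, ℂ) f e)

/-- The form `2∂φ = dφ - i I^* dφ` of a map `φ : M → ℝ³`, where `I` is the complex structure. -/
def twoDel (φ : M → R3) : Form10 M := fun p =>
  complexLinearPart (mfderiv 𝓘(ℝ, ℂ) 𝓘(ℝ, R3) φ p)

end Forms

/-- A holomorphic Weierstrass representation of `M`: a nowhere vanishing `ℂ³`-valued `(1,0)`-form,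
holomorphic as a map `TM → ℂ³`, with values in the cone
`Q = {w ∈ ℂ³ | w₀² + w₁² + w₂² = 0}`. -/
structure HolomorphicWeierstrassRep (M : Type*) [TopologicalSpace M] [ChartedSpace ℂ M]
    [IsManifold 𝓘(ℂ, ℂ) ω M] where
  form : Form10 M
  holomorphic : MDifferentiable 𝓘(ℂ, ℂ).tangent 𝓘(ℂ, C3)
    (fun x : TangentBundle 𝓘(ℂ, ℂ) M => form x.proj x.snd)
  nonvanishing : ∀ p, form p ≠ 0
  isotropic : ∀ (p : M) (w : TangentSpace 𝓘(ℂ, ℂ) p), ∑ i, (form p w i) ^ 2 = 0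

section Immersions

variable {M : Type*} [TopologicalSpace M] [ChartedSpace ℂ M]

/-- Smooth conformal immersions `M → ℝ³`. The conformal class on the tangent space at `p` is that
of the standard inner product on `ℂ` under the identification of the tangent space with `ℂ` by a
holomorphic chart. -/
structure IsConformalImmersion (φ : M → R3) : Prop where
  smooth : ContMDiff 𝓘(ℝ, ℂ) 𝓘(ℝ, R3) ∞ φ
  immersion : ∀ p, Function.Injective (mfderiv 𝓘(ℝ, ℂ) 𝓘(ℝ, R3) φ p)
  conformal : ∀ p, IsConformalMap (show ℂ →L[ℝ] R3 from mfderiv 𝓘(ℝ, ℂ) 𝓘(ℝ, R3) φ p)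

/-- The real basis `1, i` of `ℂ`. -/
def stdBasis : Fin 2 → ℂ := ![1, Complex.I]

/-- The matrix of the first fundamental form of a parametrized surface `ψ` at `z`. -/
def firstFundamentalForm (ψ : ℂ → R3) (z : ℂ) : Matrix (Fin 2) (Fin 2) ℝ :=
  Matrix.of fun i j => inner ℝ (fderiv ℝ ψ z (stdBasis i)) (fderiv ℝ ψ z (stdBasis j))

/-- The matrix of the second fundamental form of a parametrized surface `ψ` at `z` in the
direction of the normal vector `n`. -/
def secondFundamentalForm (ψ : ℂ → R3) (z : ℂ) (n : R3) : Matrix (Fin 2) (Fin 2) ℝ :=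
  Matrix.of fun i j => inner ℝ (fderiv ℝ (fderiv ℝ ψ) z (stdBasis i) (stdBasis j)) n

/-- The mean curvature of a parametrized surface `ψ` at `z` with respect to the normal vector
`n`: half the trace of the shape operator. -/
def meanCurvature (ψ : ℂ → R3) (z : ℂ) (n : R3) : ℝ :=
  ((firstFundamentalForm ψ z)⁻¹ * secondFundamentalForm ψ z n).trace / 2

/-- An immersion is minimal if its mean curvature vanishes at every point. The mean curvature at
`p` does not depend on the chart; it is computed in the preferred chart at `p`. -/
def IsMinimal (φ : M → R3) : Prop :=
  ∀ (p : M) (n : R3), ‖n‖ = 1 →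
    (∀ w : ℂ, inner ℝ (fderiv ℝ (φ ∘ (chartAt ℂ p).symm) (chartAt ℂ p p) w) n = 0) → meanCurvature (φ ∘ (chartAt ℂ p).symm) (chartAt ℂ p p) n = 0

end Immersions

section Periods

variable {M : Type*} [TopologicalSpace M] [ChartedSpace ℂ M]
  {V : Type*} [NormedAddCommGroup V] [NormedSpace ℝ V]

/-- Piecewise smooth paths. -/
def IsPiecewiseSmooth {p q : M} (γ : Path p q) : Prop :=
  ∃ (n : ℕ) (t : Fin (n + 1) → ℝ), StrictMono t ∧ t 0 = 0 ∧ t (Fin.last n) = 1 ∧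
    ∀ i : Fin n, ContMDiffOn 𝓘(ℝ, ℝ) 𝓘(ℝ, ℂ) ∞ γ.extend (Set.Icc (t i.castSucc) (t i.succ))

/-- The integral of a one-form along a path. -/
def lineIntegral (η : RealForm M V) {p q : M} (γ : Path p q) : V :=
  ∫ t in (0 : ℝ)..1, η (γ.extend t) (mfderiv 𝓘(ℝ, ℝ) 𝓘(ℝ, ℂ) γ.extend t (1 : ℝ))

/-- The set of periods of a closed one-form: its integrals along piecewise smooth loops. -/
def periods (η : RealForm M V) : Set V :=
  {c | ∃ (p : M) (γ : Path p p), IsPiecewiseSmooth γ ∧ lineIntegral η γ = c}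

/-- The kernel of the homomorphism `π₁(M, p) → V` that integrates the closed one-form `η` along
piecewise smooth representatives of homotopy classes of loops. -/
def periodKernel (η : RealForm M V) (p : M) : Set (FundamentalGroup M p) :=
  {g | ∃ γ : Path p p, IsPiecewiseSmooth γ ∧ Path.Homotopic.Quotient.mk γ = g ∧
    lineIntegral η γ = 0}

/-- `π : E → M` is the covering `M_η → M` of the closed one-form `η`: the connected covering with
`π_* π₁(E, e)` equal to the kernel of the period homomorphism of `η`, and with the complex
structure lifted from `M`. -/
structure IsPeriodCovering (η : RealForm M V) {E : Type*} [TopologicalSpace E] [ChartedSpace ℂ E]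
    (π : C(E, M)) : Prop where
  connected : ConnectedSpace E
  covering : IsCoveringMap π
  localBiholomorphism : IsLocalDiffeomorph 𝓘(ℂ, ℂ) 𝓘(ℂ, ℂ) ω π
  range_map : ∀ e : E,
    ((FundamentalGroup.map π e).range : Set (FundamentalGroup M (π e))) = periodKernel η (π e)

/-- The period condition: all periods of the `(1,0)`-form `α` are purely imaginary. -/
def HasImaginaryPeriods (α : Form10 M) : Prop :=
  ∀ c ∈ periods α.toReal, ∀ i, (c i).re = 0

end Periods

end

/-! Taking real parts is a bijection from complex-linear maps `ℂ → ℂ³` to real-linear maps `ℂ → ℝ³`,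
so `2∂φ = α` says exactly that `dφ = Re α`: the immersions sought are primitives of `Re ω`. Every
primitive qualifies. Isotropy makes its differential conformal (`inner_reSMul`), and holomorphy
makes it harmonic in a chart, so the second fundamental form is trace-free in conformal coordinates
(`meanCurvature_eq_zero_of_hasFDerivAt`). Uniqueness up to translation is connectedness.

Globally, a holomorphic form has local primitives, unique up to constants, so the germs of
primitives of `Re ω` form a covering of `M`. Evaluation of germs is a developing map `φ` on it, and
a germ is determined by its base point and its value (`IsLocallyExact.exists_isCoveringMap`). Along
a lift of `γ`, `φ` grows by `∫_γ Re ω` (`IsDeveloping.sub_eq_lineIntegral`), so a loop lifts to a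
loop exactly when its period vanishes. Hence a component of the germ space is a period covering.
Conversely, the lifting criterion maps any period covering into the germ space, and `φ` pulls back
to a global primitive (`IsPeriodCovering.exists_isDeveloping`).

The same monodromy argument shows that the covering is bijective iff `Re ω` has no periods
(`IsPeriodCovering.bijective_iff`); then the identity of `M` is itself a period covering, which
yields the immersion of `M`. Periods are integrals over piecewise smooth loops, and
`exists_isPiecewiseSmooth_homotopic` connects these with homotopy classes. -/

noncomputable section

/-! ### From the complex structure to the underlying real one -/

section RestrictScalars

variable {M : Type*} [TopologicalSpace M] [ChartedSpace ℂ M]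
  {F : Type*} [NormedAddCommGroup F] [NormedSpace ℂ F]
  {N : Type*} [TopologicalSpace N] [ChartedSpace F N]

theorem HasMFDerivAt.restrictScalars_real {f : M → N} {p : M} {L : ℂ →L[ℂ] F}
    (h : HasMFDerivAt 𝓘(ℂ, ℂ) 𝓘(ℂ, F) f p L) :
    HasMFDerivAt 𝓘(ℝ, ℂ) 𝓘(ℝ, F) f p (L.restrictScalars ℝ) :=
  ⟨h.1, HasFDerivWithinAt.restrictScalars ℝ h.2⟩

theorem ContMDiffWithinAt.restrictScalars_real {f : M → N} {p : M} {s : Set M} {n : WithTop ℕ∞}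
    (h : ContMDiffWithinAt 𝓘(ℂ, ℂ) 𝓘(ℂ, F) n f s p) :
    ContMDiffWithinAt 𝓘(ℝ, ℂ) 𝓘(ℝ, F) n f s p :=
  ⟨h.1, ContDiffWithinAt.restrict_scalars ℝ h.2⟩

theorem IsManifold.restrictScalars_real {n : WithTop ℕ∞} [IsManifold 𝓘(ℂ, ℂ) n M] :
    IsManifold 𝓘(ℝ, ℂ) n M :=
  isManifold_of_contDiffOn 𝓘(ℝ, ℂ) n M fun _ _ he he' =>
    ContDiffOn.restrict_scalars ℝ
      ((contDiffGroupoid n 𝓘(ℂ, ℂ)).compatible he he').1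

end RestrictScalars

/-! ### Primitives of real one-forms -/

section Primitives

variable {M : Type*} [TopologicalSpace M] [ChartedSpace ℂ M]
  {V : Type*} [NormedAddCommGroup V] [NormedSpace ℝ V]

/-- `f` is a smooth primitive of the one-form `η` on `U`. -/
structure IsPrimitiveOn (η : RealForm M V) (f : M → V) (U : Set M) : Prop where
  contMDiffOn : ContMDiffOn 𝓘(ℝ, ℂ) 𝓘(ℝ, V) ∞ f U
  hasMFDerivAt : ∀ q ∈ U, HasMFDerivAt 𝓘(ℝ, ℂ) 𝓘(ℝ, V) f q (η q)

/-- A one-form is locally exact if it has smooth primitives near every point. -/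
def IsLocallyExact (η : RealForm M V) : Prop :=
  ∀ p : M, ∃ (U : Set M) (f : M → V), IsOpen U ∧ p ∈ U ∧ IsPrimitiveOn η f U

theorem IsPrimitiveOn.mono {η : RealForm M V} {f : M → V} {U U' : Set M}
    (h : IsPrimitiveOn η f U) (hU : U' ⊆ U) : IsPrimitiveOn η f U' :=
  ⟨h.1.mono hU, fun q hq => h.2 q (hU hq)⟩

theorem IsPrimitiveOn.add_const {η : RealForm M V} {f : M → V} {U : Set M}
    (h : IsPrimitiveOn η f U) (c : V) : IsPrimitiveOn η (fun q => f q + c) U := by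
  refine ⟨h.1.add contMDiffOn_const, fun q hq => ?_⟩
  have := (h.2 q hq).add (hasMFDerivAt_const (I := 𝓘(ℝ, ℂ)) (I' := 𝓘(ℝ, V)) c q)
  exact this.congr_mfderiv (add_zero (η q))

theorem IsPrimitiveOn.clm_comp {η : RealForm M V} {f : M → V} {U : Set M}
    (h : IsPrimitiveOn η f U) {V' : Type*} [NormedAddCommGroup V'] [NormedSpace ℝ V']
    (L : V →L[ℝ] V') : IsPrimitiveOn (fun p => L.comp (η p)) (fun q => L (f q)) U := by
  refine ⟨L.contMDiff.comp_contMDiffOn h.1, fun q hq => ?_⟩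
  exact (L.hasFDerivAt.hasMFDerivAt (x := f q)).comp q (h.2 q hq)

variable [IsManifold 𝓘(ℂ, ℂ) ω M]

theorem hasFDerivAt_comp_chartAt_symm {f : M → V} {p : M} {z : ℂ} (hz : z ∈ (chartAt ℂ p).target)
    {L : ℂ →L[ℝ] V}
    (h : HasMFDerivAt 𝓘(ℝ, ℂ) 𝓘(ℝ, V) f ((chartAt ℂ p).symm z) L) :
    HasFDerivAt (f ∘ (chartAt ℂ p).symm)
      (L.comp ((show ℂ →L[ℂ] ℂ from
        mfderiv 𝓘(ℂ, ℂ) 𝓘(ℂ, ℂ) (chartAt ℂ p).symm z).restrictScalars ℝ)) z := by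
  have : IsManifold 𝓘(ℂ, ℂ) 1 M := IsManifold.of_le (n := ω) le_top
  have h2 := (mdifferentiableAt_atlas_symm (I := 𝓘(ℂ, ℂ)) (chart_mem_atlas ℂ p) hz).hasMFDerivAt
  have h3 : HasMFDerivAt 𝓘(ℝ, ℂ) 𝓘(ℝ, ℂ) (chartAt ℂ p).symm z _ :=
    HasMFDerivAt.restrictScalars_real h2
  exact (HasMFDerivAt.comp z h h3).hasFDerivAt

/-- A function with vanishing derivative on an open set is locally constant there. -/
theorem eventually_eq_of_hasMFDerivAt_zero {f : M → V} {U : Set M} (hU : IsOpen U)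
    (h : ∀ q ∈ U, HasMFDerivAt 𝓘(ℝ, ℂ) 𝓘(ℝ, V) f q 0) {p : M} (hp : p ∈ U) :
    ∀ᶠ q in 𝓝 p, f q = f p := by
  set c := chartAt ℂ p with hc
  have hps : p ∈ c.source := mem_chart_source ℂ p
  have hO : IsOpen (c.target ∩ c.symm ⁻¹' U) := c.isOpen_inter_preimage_symm hU
  have hmem : c p ∈ c.target ∩ c.symm ⁻¹' U :=
    ⟨c.map_source hps, by simpa [c.left_inv hps] using hp⟩
  obtain ⟨r, hr, hball⟩ := Metric.isOpen_iff.1 hO _ hmem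
  have hd : ∀ z ∈ Metric.ball (c p) r, HasFDerivAt (f ∘ c.symm) (0 : ℂ →L[ℝ] V) z := by
    intro z hz
    have := hasFDerivAt_comp_chartAt_symm (hball hz).1 (h _ (hball hz).2)
    exact this.congr_fderiv (ContinuousLinearMap.zero_comp _)
  have hconst : ∀ z ∈ Metric.ball (c p) r, (f ∘ c.symm) z = (f ∘ c.symm) (c p) := fun z hz =>
    (convex_ball (c p) r).is_const_of_fderivWithin_eq_zero (𝕜 := ℝ)
      (fun z hz => (hd z hz).differentiableAt.differentiableWithinAt)
      (fun z hz => by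
        rw [fderivWithin_of_isOpen Metric.isOpen_ball hz]
        exact (hd z hz).fderiv) hz (Metric.mem_ball_self hr)
  filter_upwards [c.continuousAt hps (Metric.ball_mem_nhds _ hr), c.open_source.mem_nhds hps]
    with q hq hqs
  have := hconst _ hq
  simpa [c.left_inv hps, c.left_inv hqs] using this

/-- This makes the transition functions of the germ bundle locally constant, and it gives uniqueness
up to translation. -/
theorem IsPrimitiveOn.eventually_eq_add {η : RealForm M V} {f g : M → V} {U : Set M}
    (hU : IsOpen U) (hf : IsPrimitiveOn η f U) (hg : IsPrimitiveOn η g U) {p : M} (hp : p ∈ U) :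
    ∀ᶠ q in 𝓝 p, f q - g q = f p - g p :=
  eventually_eq_of_hasMFDerivAt_zero (f := fun q => f q - g q) hU (fun q hq => by
    have := (hf.2 q hq).sub (hg.2 q hq)
    exact this.congr_mfderiv (sub_self (η q))) hp

end Primitives

/-! ### Local exactness of holomorphic forms -/

section HolomorphicForms

variable {M : Type*} [TopologicalSpace M] [ChartedSpace ℂ M]

/-- The coefficient of a `(1,0)`-form in the preferred chart at `p`. -/
def Form10.coeff (α : Form10 M) (p : M) (z : ℂ) : C3 :=
  (show ℂ →L[ℂ] C3 from α ((chartAt ℂ p).symm z))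
    ((show ℂ →L[ℂ] ℂ from mfderiv 𝓘(ℂ, ℂ) 𝓘(ℂ, ℂ) (chartAt ℂ p).symm z) 1)

variable [IsManifold 𝓘(ℂ, ℂ) ω M]

/-- Holomorphy is given on the total space of `TM`. The coefficient is the form evaluated along the
coordinate vector field, the image of the constant section `1` under the tangent map of the inverse
chart, which is holomorphic. -/
theorem Form10.differentiableOn_coeff {α : Form10 M}
    (hα : MDifferentiable 𝓘(ℂ, ℂ).tangent 𝓘(ℂ, C3)
      (fun x : TangentBundle 𝓘(ℂ, ℂ) M => α x.proj x.snd)) (p : M) :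
    DifferentiableOn ℂ (α.coeff p) (chartAt ℂ p).target := by
  have : IsManifold 𝓘(ℂ, ℂ) 1 M := IsManifold.of_le (n := ω) le_top
  intro z hz
  have ho : IsOpen (chartAt ℂ p).target := (chartAt ℂ p).open_target
  have h1 := (contMDiffOn_chart_symm (I := 𝓘(ℂ, ℂ)) (n := ω) (x := p)).contMDiffOn_tangentMapWithin
    (m := 1) (n := ω) le_top ho.uniqueMDiffOn
  have hs : ContMDiff 𝓘(ℂ, ℂ) 𝓘(ℂ, ℂ).tangent 1
      (fun z : ℂ => (⟨z, (1 : ℂ)⟩ : TangentBundle 𝓘(ℂ, ℂ) ℂ)) := by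
    exact contMDiff_vectorSpace_iff_contDiff.2 contDiff_const
  have h2 : MDifferentiableWithinAt 𝓘(ℂ, ℂ) 𝓘(ℂ, ℂ).tangent
      (fun z => tangentMapWithin 𝓘(ℂ, ℂ) 𝓘(ℂ, ℂ) (chartAt ℂ p).symm (chartAt ℂ p).target
        (⟨z, (1 : ℂ)⟩ : TangentBundle 𝓘(ℂ, ℂ) ℂ)) (chartAt ℂ p).target z :=
    ((h1.comp hs.contMDiffOn (fun z hz => hz)) z hz).mdifferentiableWithinAt one_ne_zero
  have h3 := (hα.mdifferentiableAt).comp_mdifferentiableWithinAt z h2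
  refine DifferentiableWithinAt.congr (mdifferentiableWithinAt_iff_differentiableWithinAt.1 h3)
    (fun w hw => ?_) ?_
  · simp only [Function.comp, tangentMapWithin, Form10.coeff, mfderivWithin_of_isOpen ho hw]
    rfl
  · simp only [Function.comp, tangentMapWithin, Form10.coeff, mfderivWithin_of_isOpen ho hz]
    rfl

/-- On the image of the preferred chart at `p`, a function with derivative `α` has derivative
`α.coeff p` in the chart. -/
theorem Form10.hasFDerivAt_comp_chartAt_symm {V : Type*} [NormedAddCommGroup V] [NormedSpace ℝ V]
    {α : Form10 M} {A : C3 →L[ℝ] V} {f : M → V} {p : M} {z : ℂ}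
    (hz : z ∈ (chartAt ℂ p).target)
    (h : HasMFDerivAt 𝓘(ℝ, ℂ) 𝓘(ℝ, V) f ((chartAt ℂ p).symm z)
      (A.comp (α.toReal ((chartAt ℂ p).symm z)))) :
    HasFDerivAt (f ∘ (chartAt ℂ p).symm)
      (A.comp (((1 : ℂ →L[ℂ] ℂ).smulRight (α.coeff p z)).restrictScalars ℝ)) z := by
  refine (_root_.hasFDerivAt_comp_chartAt_symm hz h).congr_fderiv ?_
  ext w
  change A ((show ℂ →L[ℂ] C3 from α ((chartAt ℂ p).symm z))
    ((show ℂ →L[ℂ] ℂ from mfderiv 𝓘(ℂ, ℂ) 𝓘(ℂ, ℂ) (chartAt ℂ p).symm z) w)) = A (w • α.coeff p z)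
  rw [Form10.coeff, ← map_smul, ← map_smul, smul_eq_mul, mul_one]

/-- A holomorphic form is locally exact. -/
theorem Form10.isLocallyExact_toReal {α : Form10 M}
    (hα : MDifferentiable 𝓘(ℂ, ℂ).tangent 𝓘(ℂ, C3)
      (fun x : TangentBundle 𝓘(ℂ, ℂ) M => α x.proj x.snd)) : IsLocallyExact α.toReal := by
  have : IsManifold 𝓘(ℂ, ℂ) 1 M := IsManifold.of_le (n := ω) le_top
  intro p
  set c := chartAt ℂ p with hc
  have hps : p ∈ c.source := mem_chart_source ℂ p
  obtain ⟨r, hr, hball⟩ := Metric.isOpen_iff.1 c.open_target _ (c.map_source hps)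
  have hh := (Form10.differentiableOn_coeff hα p).mono hball
  obtain ⟨F, hF⟩ := hh.isExactOn_ball
  have hFd : DifferentiableOn ℂ F (Metric.ball (c p) r) :=
    fun z hz => (hF z hz).differentiableAt.differentiableWithinAt
  refine ⟨c.source ∩ c ⁻¹' Metric.ball (c p) r, F ∘ c, c.isOpen_inter_preimage Metric.isOpen_ball,
    ⟨hps, Metric.mem_ball_self hr⟩, ?_, ?_⟩
  · intro q hq
    have h1 : ContMDiffOn 𝓘(ℂ, ℂ) 𝓘(ℂ, C3) ω (F ∘ c) (c.source ∩ c ⁻¹' Metric.ball (c p) r) :=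
      (hFd.contDiffOn Metric.isOpen_ball).contMDiffOn.comp
        ((contMDiffOn_chart (x := p)).mono Set.inter_subset_left) Set.inter_subset_right
    exact ((h1 q hq).restrictScalars_real).of_le le_top
  · intro q hq
    have hd := mdifferentiable_chart (I := 𝓘(ℂ, ℂ)) p
    have h2 : HasMFDerivAt 𝓘(ℂ, ℂ) 𝓘(ℂ, ℂ) c q (mfderiv 𝓘(ℂ, ℂ) 𝓘(ℂ, ℂ) c q) :=
      (mdifferentiableAt_atlas (I := 𝓘(ℂ, ℂ)) (chart_mem_atlas ℂ p) hq.1).hasMFDerivAt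
    have h3 := ((hF _ hq.2).hasFDerivAt.hasMFDerivAt).comp q h2
    have h4 := HasMFDerivAt.restrictScalars_real h3
    refine h4.congr_mfderiv ?_
    -- The coefficient contains the derivative of `c.symm`, which cancels against that of `c` and
    -- leaves `α`.
    have h5 := hd.symm_comp_deriv hq.1
    ext1 w
    have h6 := congrArg (fun L : ℂ →L[ℂ] ℂ => L w) h5
    change (show ℂ →L[ℂ] ℂ from mfderiv 𝓘(ℂ, ℂ) 𝓘(ℂ, ℂ) c.symm (c q))
      ((show ℂ →L[ℂ] ℂ from mfderiv 𝓘(ℂ, ℂ) 𝓘(ℂ, ℂ) c q) w) = w at h6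
    change (show ℂ →L[ℂ] ℂ from mfderiv 𝓘(ℂ, ℂ) 𝓘(ℂ, ℂ) c q) w • α.coeff p (c q) =
      (show ℂ →L[ℂ] C3 from α q) w
    rw [Form10.coeff, ← map_smul, ← map_smul, smul_eq_mul, mul_one, h6, c.left_inv hq.1]

theorem Form10.isLocallyExact_re {α : Form10 M}
    (hα : MDifferentiable 𝓘(ℂ, ℂ).tangent 𝓘(ℂ, C3)
      (fun x : TangentBundle 𝓘(ℂ, ℂ) M => α x.proj x.snd)) : IsLocallyExact α.re := fun p =>
  let ⟨U, f, hU, hp, hf⟩ := Form10.isLocallyExact_toReal hα p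
  ⟨U, fun q => reC3 (f q), hU, hp, hf.clm_comp reC3⟩

end HolomorphicForms

/-! ### Real parts of complex-linear maps and isotropic vectors -/

section LinearAlgebra

@[simp] theorem reC3_apply (w : C3) (i : Fin 3) : reC3 w i = (w i).re := rfl

theorem complexLinearPart_apply (L : ℂ →L[ℝ] R3) (v : ℂ) (i : Fin 3) :
    complexLinearPart L v i = ((L v i : ℝ) : ℂ) - Complex.I * ((L (Complex.I * v) i : ℝ) : ℂ) := rfl

/-- The imaginary part of `L v` is `-Re L (i v)`. With the next lemma, `L ↦ Re L` is a bijection. -/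
theorem complexLinearPart_re (L : ℂ →L[ℂ] C3) :
    complexLinearPart (reC3.comp (L.restrictScalars ℝ)) = L := by
  ext1
  ext i
  rw [complexLinearPart_apply]
  have : L (Complex.I * 1) = Complex.I • L 1 := by rw [← smul_eq_mul, map_smul]
  simp only [ContinuousLinearMap.comp_apply, ContinuousLinearMap.coe_restrictScalars', reC3_apply,
    this]
  apply Complex.ext <;> simp

theorem reC3_comp_complexLinearPart (L : ℂ →L[ℝ] R3) :
    reC3.comp ((complexLinearPart L).restrictScalars ℝ) = L := by
  ext v i
  simp [complexLinearPart_apply]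

/-- The real-linear map `v ↦ Re (v w)`. -/
def reSMul : C3 →L[ℝ] ℂ →L[ℝ] R3 :=
  LinearMap.toContinuousLinearMap
    { toFun := fun w => reC3.comp (((1 : ℂ →L[ℂ] ℂ).smulRight w).restrictScalars ℝ)
      map_add' := fun x y => by ext v i; simp
      map_smul' := fun c x => by ext v i; simp; ring }

theorem reSMul_apply (w : C3) (v : ℂ) : reSMul w v = reC3 (v • w) := rfl

theorem reC3_comp_eq_reSMul (L : ℂ →L[ℂ] C3) :
    reC3.comp (L.restrictScalars ℝ) = reSMul (L 1) := by
  ext v i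
  have : L v = v • L 1 := by rw [← map_smul, smul_eq_mul, mul_one]
  simp only [reSMul_apply, ContinuousLinearMap.comp_apply, ContinuousLinearMap.coe_restrictScalars',
    this]

/-- For `w = a + ib`, the images of `1` and `i` are `a` and `-b`, and isotropy says that `|a| = |b|`
and `a ⊥ b`. -/
theorem inner_reSMul {w : C3} (hw : ∑ i, w i ^ 2 = 0) (u v : ℂ) :
    inner ℝ (reSMul w u) (reSMul w v) = (∑ i, (w i).re ^ 2) * inner ℝ u v := by
  have h1 := congrArg Complex.re hw
  have h2 := congrArg Complex.im hw
  simp only [Fin.sum_univ_three, pow_two, Complex.add_re, Complex.add_im, Complex.mul_re,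
    Complex.mul_im, Complex.zero_re, Complex.zero_im] at h1 h2
  simp only [PiLp.inner_apply, reSMul_apply, reC3_apply, PiLp.smul_apply, smul_eq_mul,
    Fin.sum_univ_three, RCLike.inner_apply, conj_trivial, Complex.inner, Complex.mul_re,
    Complex.conj_re, Complex.conj_im]
  linear_combination (-u.im * v.im) * h1 - ((u.re * v.im + u.im * v.re) / 2) * h2

theorem sum_re_sq_pos {w : C3} (hw : ∑ i, w i ^ 2 = 0) (h0 : w ≠ 0) :
    0 < ∑ i, (w i).re ^ 2 := by
  have h1 := congrArg Complex.re hw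
  simp only [Fin.sum_univ_three, pow_two, Complex.add_re, Complex.mul_re, Complex.zero_re] at h1
  refine lt_of_le_of_ne (Finset.sum_nonneg fun i _ => sq_nonneg _) fun h => h0 ?_
  have h2 : ∑ i, (w i).im ^ 2 = 0 := by
    rw [Fin.sum_univ_three] at h ⊢
    linarith
  have h3 := (Finset.sum_eq_zero_iff_of_nonneg fun i _ => sq_nonneg ((w i).re)).1 h.symm
  have h4 := (Finset.sum_eq_zero_iff_of_nonneg fun i _ => sq_nonneg ((w i).im)).1 h2
  ext i
  exact Complex.ext (pow_eq_zero_iff two_ne_zero |>.1 (h3 i (Finset.mem_univ i)))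
    (pow_eq_zero_iff two_ne_zero |>.1 (h4 i (Finset.mem_univ i)))

theorem isConformalMap_reSMul {w : C3} (hw : ∑ i, w i ^ 2 = 0) (h0 : w ≠ 0) :
    IsConformalMap (reSMul w) :=
  (isConformalMap_iff _).2 ⟨_, sum_re_sq_pos hw h0, inner_reSMul hw⟩

end LinearAlgebra

/-! ### Vanishing mean curvature -/

section Curvature

/-- A parametrized surface whose derivative is the real part of an isotropic holomorphic map has
vanishing mean curvature. -/
theorem meanCurvature_eq_zero_of_hasFDerivAt {ψ : ℂ → R3} {h : ℂ → C3} {U : Set ℂ}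
    (hU : IsOpen U) (hh : DifferentiableOn ℂ h U)
    (hψ : ∀ z ∈ U, HasFDerivAt ψ (reSMul (h z)) z) {z : ℂ} (hz : z ∈ U)
    (hiso : ∑ i, h z i ^ 2 = 0) (n : R3) : meanCurvature ψ z n = 0 := by
  have hev : fderiv ℝ ψ =ᶠ[𝓝 z] fun y => reSMul (h y) := by
    filter_upwards [hU.mem_nhds hz] with y hy using (hψ y hy).fderiv
  have hd : HasFDerivAt h ((fderiv ℂ h z).restrictScalars ℝ) z :=
    ((hh z hz).differentiableAt (hU.mem_nhds hz)).hasFDerivAt.restrictScalars ℝ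
  have h2 : fderiv ℝ (fderiv ℝ ψ) z = reSMul.comp ((fderiv ℂ h z).restrictScalars ℝ) := by
    rw [hev.fderiv_eq]
    exact (reSMul.hasFDerivAt.comp z hd).fderiv
  have hI : fderiv ℂ h z Complex.I = Complex.I • fderiv ℂ h z 1 := by
    rw [← map_smul, smul_eq_mul, mul_one]
  have hfff : firstFundamentalForm ψ z =
      (∑ i, (h z i).re ^ 2) • (1 : Matrix (Fin 2) (Fin 2) ℝ) := by
    ext i j
    simp only [firstFundamentalForm, Matrix.of_apply, (hψ z hz).fderiv, inner_reSMul hiso,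
      Matrix.smul_apply, smul_eq_mul]
    congr 1
    fin_cases i <;> fin_cases j <;> simp [stdBasis, Complex.inner]
  have hsff : (secondFundamentalForm ψ z n).trace = 0 := by
    -- The second derivative is `(u, v) ↦ Re (u v h')`, so `i² = -1` makes `ψ` harmonic.
    have hneg : fderiv ℝ (fderiv ℝ ψ) z Complex.I Complex.I = - fderiv ℝ (fderiv ℝ ψ) z 1 1 := by
      rw [h2]
      simp only [ContinuousLinearMap.comp_apply, ContinuousLinearMap.coe_restrictScalars', hI,
        reSMul_apply, smul_smul, Complex.I_mul_I, one_smul, neg_smul, map_neg]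
    simp [Matrix.trace_fin_two, secondFundamentalForm, stdBasis, hneg, inner_neg_left]
  rw [meanCurvature, hfff]
  -- If the conformal factor is zero, the inverse of the zero matrix is zero by convention, and so
  -- is the trace.
  by_cases hc : (∑ i, (h z i).re ^ 2) = 0
  · rw [hc, zero_smul]
    simp
  · rw [← Units.smul_mk0 hc, Matrix.inv_smul' _ _ (by simp)]
    simp [hsff]

end Curvature

/-! ### Primitives of `Re ω` are minimal conformal immersions -/

section Weierstrass

theorem IsConformalImmersion.isPrimitiveOn {M : Type*} [TopologicalSpace M] [ChartedSpace ℂ M] {φ : M → R3}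
    {α : Form10 M} (h : IsConformalImmersion φ)
    (hα : twoDel φ = α) : IsPrimitiveOn α.re φ Set.univ := by
  refine ⟨h.smooth.contMDiffOn, fun p _ => ?_⟩
  refine ((h.smooth.mdifferentiable (by simp)) p).hasMFDerivAt.congr_mfderiv ?_
  subst hα
  exact (reC3_comp_complexLinearPart _).symm

variable {M : Type*} [TopologicalSpace M] [ChartedSpace ℂ M] [IsManifold 𝓘(ℂ, ℂ) ω M]

theorem HolomorphicWeierstrassRep.apply_one_ne_zero (W : HolomorphicWeierstrassRep M) (p : M) :
    (show ℂ →L[ℂ] C3 from W.form p) 1 ≠ 0 := by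
  intro h
  refine W.nonvanishing p ?_
  have : (show ℂ →L[ℂ] C3 from W.form p) = 0 := by
    ext1
    exact h
  exact this

theorem HolomorphicWeierstrassRep.re_eq_reSMul (W : HolomorphicWeierstrassRep M) (p : M) :
    W.form.re p = reSMul ((show ℂ →L[ℂ] C3 from W.form p) 1) :=
  reC3_comp_eq_reSMul _

variable {W : HolomorphicWeierstrassRep M} {φ : M → R3}

theorem IsPrimitiveOn.isConformalImmersion (h : IsPrimitiveOn W.form.re φ Set.univ) :
    IsConformalImmersion φ := by
  have hm : ∀ p, IsConformalMap (show ℂ →L[ℝ] R3 from mfderiv 𝓘(ℝ, ℂ) 𝓘(ℝ, R3) φ p) := fun p => by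
    rw [(h.2 p trivial).mfderiv, W.re_eq_reSMul]
    exact isConformalMap_reSMul (W.isotropic p _) (W.apply_one_ne_zero p)
  exact ⟨contMDiffOn_univ.1 h.1, fun p => (hm p).injective, hm⟩

theorem IsPrimitiveOn.isMinimal (h : IsPrimitiveOn W.form.re φ Set.univ) : IsMinimal φ := by
  intro p n _ _
  refine meanCurvature_eq_zero_of_hasFDerivAt (chartAt ℂ p).open_target
    (Form10.differentiableOn_coeff W.holomorphic p)
    (fun z hz => Form10.hasFDerivAt_comp_chartAt_symm hz (h.2 _ trivial))
    ((chartAt ℂ p).map_source (mem_chart_source ℂ p)) ?_ n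
  exact W.isotropic _ _

theorem IsPrimitiveOn.twoDel_eq (h : IsPrimitiveOn W.form.re φ Set.univ) :
    twoDel φ = W.form := by
  funext p
  rw [twoDel, (h.2 p trivial).mfderiv]
  exact complexLinearPart_re _

/-- The pullback of a Weierstrass representation under a local biholomorphism. -/
def HolomorphicWeierstrassRep.pullback (W : HolomorphicWeierstrassRep M)
    {E : Type*} [TopologicalSpace E] [ChartedSpace ℂ E] [IsManifold 𝓘(ℂ, ℂ) ω E] {f : E → M}
    (hf : IsLocalDiffeomorph 𝓘(ℂ, ℂ) 𝓘(ℂ, ℂ) ω f) : HolomorphicWeierstrassRep E where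
  form := W.form.pullback f
  holomorphic := by
    have : IsManifold 𝓘(ℂ, ℂ) 1 M := IsManifold.of_le (n := ω) le_top
    have : IsManifold 𝓘(ℂ, ℂ) 1 E := IsManifold.of_le (n := ω) le_top
    have h : ContMDiff 𝓘(ℂ, ℂ).tangent 𝓘(ℂ, ℂ).tangent 1 (tangentMap 𝓘(ℂ, ℂ) 𝓘(ℂ, ℂ) f) :=
      hf.contMDiff.contMDiff_tangentMap (n := ω) le_top
    exact W.holomorphic.comp (h.mdifferentiable one_ne_zero)
  nonvanishing e he := by
    refine W.nonvanishing (f e) ?_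
    refine ContinuousLinearMap.ext fun v => ?_
    obtain ⟨w, rfl⟩ := (hf.mfderivToContinuousLinearEquiv (by simp) e).surjective v
    exact congrArg (fun L : ℂ →L[ℂ] C3 => L w) he
  isotropic e w := W.isotropic (f e) _

end Weierstrass

/-! ### Clopen subsets of coverings -/

section ClopenCovering

/-- The restriction of a covering map of a locally connected space to a clopen subset is a
covering map. -/
theorem IsCoveringMap.restrict_isClopen {E X : Type*} [TopologicalSpace E] [TopologicalSpace X]
    [LocallyConnectedSpace X] {p : E → X} (cov : IsCoveringMap p) {C : Set E} (hC : IsClopen C) :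
    IsCoveringMap (fun e : C => p e) := by
  intro x
  obtain ⟨_, U, hxU, hU, hpU, H, hH⟩ := cov x
  set V := connectedComponentIn U x with hV
  have hVo : IsOpen V := hU.connectedComponentIn
  have hxV : x ∈ V := mem_connectedComponentIn hxU
  have hVU : V ⊆ U := connectedComponentIn_subset U x
  have : PreconnectedSpace V := Subtype.preconnectedSpace isPreconnected_connectedComponentIn
  let s (i : p ⁻¹' {x}) (v : V) : E := (H.symm (⟨v, hVU v.2⟩, i)).1
  have hs_cont : Continuous fun vi : V × (p ⁻¹' {x}) => s vi.2 vi.1 := by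
    have : Continuous fun vi : V × (p ⁻¹' {x}) =>
        ((⟨vi.1, hVU vi.1.2⟩, vi.2) : U × (p ⁻¹' {x})) := by fun_prop
    exact continuous_subtype_val.comp (H.symm.continuous.comp this)
  have hps : ∀ i v, p (s i v) = v := fun i v => by
    have := hH (H.symm (⟨v, hVU v.2⟩, i))
    rw [H.apply_symm_apply] at this
    exact this.symm
  -- The sheet `s i` over the connected set `V` lies either inside `C` or outside it; `J` below
  -- indexes the sheets inside.
  have hall : ∀ i (v w : V), s i v ∈ C → s i w ∈ C := by
    intro i v w hv
    have h1 : IsClopen ((s i) ⁻¹' C) :=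
      hC.preimage (hs_cont.comp (Continuous.prodMk_left i))
    have := isClopen_iff.1 h1
    rcases this with h | h
    · exact absurd hv (by rw [← Set.mem_preimage, h]; exact id)
    · exact (h ▸ Set.mem_univ w : w ∈ (s i) ⁻¹' C)
  let J : Set (p ⁻¹' {x}) := {i | s i ⟨x, hxV⟩ ∈ C}
  have hkey : ∀ (e : E) (he : p e ∈ V), s (H ⟨e, hVU he⟩).2 ⟨p e, he⟩ = e := by
    intro e he
    have h1 : H ⟨e, hVU he⟩ = (⟨p e, hVU he⟩, (H ⟨e, hVU he⟩).2) :=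
      Prod.ext (Subtype.ext (hH ⟨e, hVU he⟩)) rfl
    change (H.symm (⟨p e, hVU he⟩, (H ⟨e, hVU he⟩).2)).1 = e
    rw [← h1, H.symm_apply_apply]
  have hJ : IsEvenlyCovered (fun e : C => p e) x J := by
    refine ⟨inferInstance, V, hxV, hVo, hVo.preimage (cov.continuous.comp continuous_subtype_val),
      { toFun := fun e => (⟨p e.1, e.2⟩, ⟨(H ⟨e.1, hVU e.2⟩).2,
          hall _ ⟨p e.1, e.2⟩ _ (by rw [hkey]; exact e.1.2)⟩)
        invFun := fun vj => ⟨⟨s vj.2.1 vj.1, hall _ _ _ vj.2.2⟩, by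
          change p (s _ _) ∈ V
          rw [hps]
          exact vj.1.2⟩
        left_inv := fun e => Subtype.ext (Subtype.ext (hkey _ e.2))
        right_inv := ?_
        continuous_toFun := ?_
        continuous_invFun := ?_ }, fun e => rfl⟩
    · rintro ⟨v, j⟩
      refine Prod.ext (Subtype.ext (hps _ _)) (Subtype.ext ?_)
      change (H ⟨(H.symm (⟨v, hVU v.2⟩, j.1)).1, _⟩).2 = j.1
      rw [Subtype.coe_eta, H.apply_symm_apply]
    · have hval : Continuous fun e : (fun e : C => p e) ⁻¹' V => e.1.1 :=
        continuous_subtype_val.comp continuous_subtype_val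
      exact ((cov.continuous.comp hval).subtype_mk _).prodMk
        ((continuous_snd.comp (H.continuous.comp (hval.subtype_mk _))).subtype_mk _)
    · have hJV : Continuous fun vj : V × J => (vj.1, vj.2.1) := by fun_prop
      exact ((hs_cont.comp hJV).subtype_mk _).subtype_mk _
  exact hJ.to_isEvenlyCovered_preimage

end ClopenCovering

/-! ### The lifted complex structure -/

section PullbackCharts

variable {H : Type*} [TopologicalSpace H] {E M : Type*} [TopologicalSpace E] [TopologicalSpace M]

/-- The charts of `M`, pulled back under a local homeomorphism `f : E → M`. -/
@[reducible] def IsLocalHomeomorph.pullbackChartedSpace [ChartedSpace H M] {f : E → M}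
    (hf : IsLocalHomeomorph f) : ChartedSpace H E where
  atlas := Set.range fun e => (hf e).choose.trans (chartAt H (f e))
  chartAt e := (hf e).choose.trans (chartAt H (f e))
  mem_chart_source e := by
    have h := (hf e).choose_spec
    rw [OpenPartialHomeomorph.trans_source]
    refine ⟨h.1, ?_⟩
    rw [Set.mem_preimage, ← h.2]
    exact mem_chart_source H (f e)
  chart_mem_atlas e := ⟨e, rfl⟩

/-- The local homeomorphisms `φ` and `χ` in two pulled-back charts both agree with `f`, so they
cancel and leave a coordinate change of `M`. -/
theorem IsLocalHomeomorph.isManifold_pullback [ChartedSpace ℂ M] [IsManifold 𝓘(ℂ, ℂ) ω M]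
    {f : E → M} (hf : IsLocalHomeomorph f) :
    letI := hf.pullbackChartedSpace (H := ℂ)
    IsManifold 𝓘(ℂ, ℂ) ω E := by
  let _ := hf.pullbackChartedSpace (H := ℂ)
  refine isManifold_of_contDiffOn 𝓘(ℂ, ℂ) ω E ?_
  rintro _ _ ⟨a, rfl⟩ ⟨b, rfl⟩
  have ha := (hf a).choose_spec
  have hb := (hf b).choose_spec
  set φ := (hf a).choose
  set χ := (hf b).choose
  have hM := ((contDiffGroupoid ω 𝓘(ℂ, ℂ)).compatible (chart_mem_atlas ℂ (f a))
    (chart_mem_atlas ℂ (f b))).1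
  have key : ∀ z ∈ ((φ.trans (chartAt ℂ (f a))).symm.trans (χ.trans (chartAt ℂ (f b)))).source,
      χ (φ.symm ((chartAt ℂ (f a)).symm z)) = (chartAt ℂ (f a)).symm z := by
    intro z hz
    simp only [OpenPartialHomeomorph.trans_source, OpenPartialHomeomorph.symm_source,
      OpenPartialHomeomorph.trans_target, Set.mem_inter_iff, Set.mem_preimage] at hz
    exact (congrFun hb.2 _).symm.trans ((congrFun ha.2 _).trans (φ.right_inv hz.1.2))
  refine (hM.mono ?_).congr ?_
  · simp only [mfld_simps]
    intro z hz
    have hk := key z (by simpa only [mfld_simps] using hz)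
    simp only [mfld_simps] at hz
    refine ⟨hz.1.1, ?_⟩
    have := hz.2.2
    rwa [hk] at this
  · intro z hz
    have hk := key z (by simpa only [mfld_simps] using hz)
    simp only [mfld_simps]
    rw [hk]

theorem IsLocalHomeomorph.isLocalDiffeomorph_pullback [ChartedSpace ℂ M] [IsManifold 𝓘(ℂ, ℂ) ω M]
    {f : E → M} (hf : IsLocalHomeomorph f) :
    letI := hf.pullbackChartedSpace (H := ℂ)
    IsLocalDiffeomorph 𝓘(ℂ, ℂ) 𝓘(ℂ, ℂ) ω f := by
  let _ := hf.pullbackChartedSpace (H := ℂ)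
  have := hf.isManifold_pullback
  intro e
  let Φ := (chartAt ℂ e).trans (chartAt ℂ (f e)).symm
  refine ⟨⟨Φ.toPartialEquiv, Φ.open_source, Φ.open_target, ?_, ?_⟩, ?_, ?_⟩
  · exact (contMDiffOn_chart_symm (x := f e)).comp
      ((contMDiffOn_chart (x := e)).mono fun z hz => hz.1) fun z hz => hz.2
  · exact (contMDiffOn_chart_symm (x := e)).comp
      ((contMDiffOn_chart (x := f e)).mono fun z hz => hz.1) fun z hz => hz.2
  · have h : e ∈ (chartAt ℂ e).source := mem_chart_source ℂ e
    refine ⟨h, ?_⟩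
    exact (chartAt ℂ (f e)).map_source h.2
  · intro x hx
    have h := (hf e).choose_spec
    exact (congrFun h.2 x).trans ((chartAt ℂ (f e)).left_inv hx.1.2).symm

end PullbackCharts

/-! ### Developing maps -/

section Developing

variable {M : Type*} [TopologicalSpace M] [ChartedSpace ℂ M]
  {V : Type*} [NormedAddCommGroup V] [NormedSpace ℝ V]
  {E : Type*} [TopologicalSpace E]

/-- `φ : E → V` is a developing map of the one-form `η` along `π : E → M`: locally, `φ` is the
pullback of a smooth primitive of `η`. -/
def IsDeveloping (η : RealForm M V) (π : E → M) (φ : E → V) : Prop :=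
  ∀ e, ∃ (U : Set M) (f : M → V), IsOpen U ∧ π e ∈ U ∧ IsPrimitiveOn η f U ∧
    ∀ᶠ e' in 𝓝 e, φ e' = f (π e')

theorem IsDeveloping.comp {E' : Type*} [TopologicalSpace E'] {η : RealForm M V} {π : E → M}
    {φ : E → V} (h : IsDeveloping η π φ) {F : E' → E} (hF : Continuous F) :
    IsDeveloping η (π ∘ F) (φ ∘ F) := fun e' => by
  obtain ⟨U, f, hU, he, hf, hev⟩ := h (F e')
  exact ⟨U, f, hU, he, hf, hF.continuousAt hev⟩

theorem IsDeveloping.clm_comp {η : RealForm M V} {π : E → M}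
    {φ : E → V} (h : IsDeveloping η π φ) {V' : Type*} [NormedAddCommGroup V'] [NormedSpace ℝ V']
    (L : V →L[ℝ] V') : IsDeveloping (fun p => L.comp (η p)) π (fun e => L (φ e)) := fun e => by
  obtain ⟨U, f, hU, he, hf, hev⟩ := h e
  exact ⟨U, fun q => L (f q), hU, he, hf.clm_comp L, hev.mono fun e' h => congrArg L h⟩

theorem IsPrimitiveOn.isDeveloping_id {η : RealForm M V} {φ : M → V}
    (h : IsPrimitiveOn η φ Set.univ) : IsDeveloping η id φ := fun _ =>
  ⟨Set.univ, φ, isOpen_univ, trivial, h, Filter.Eventually.of_forall fun _ => rfl⟩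

/-- A developing map along a local biholomorphism is a primitive of the pullback. -/
theorem IsDeveloping.isPrimitiveOn_pullback [ChartedSpace ℂ E] {α : Form10 M} {A : C3 →L[ℝ] V}
    {π : E → M} (hπ : IsLocalDiffeomorph 𝓘(ℂ, ℂ) 𝓘(ℂ, ℂ) ω π) {φ : E → V}
    (h : IsDeveloping (fun p => A.comp (α.toReal p)) π φ) :
    IsPrimitiveOn (fun e => A.comp ((α.pullback π).toReal e)) φ Set.univ := by
  refine ⟨fun e _ => ?_, fun e _ => ?_⟩
  · obtain ⟨U, f, hU, he, hf, hev⟩ := h e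
    have h1 : ContMDiffAt 𝓘(ℝ, ℂ) 𝓘(ℝ, V) ∞ f (π e) := (hf.1 _ he).contMDiffAt (hU.mem_nhds he)
    have h2 : ContMDiffAt 𝓘(ℝ, ℂ) 𝓘(ℝ, ℂ) ω π e :=
      ContMDiffWithinAt.restrictScalars_real (hπ.contMDiff e)
    exact ((h1.comp e (h2.of_le le_top)).congr_of_eventuallyEq hev).contMDiffWithinAt
  · obtain ⟨U, f, hU, he, hf, hev⟩ := h e
    have h2 := HasMFDerivAt.restrictScalars_real (hπ.mdifferentiable (by simp) e).hasMFDerivAt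
    exact ((hf.2 _ he).comp e h2).congr_of_eventuallyEq hev

end Developing

/-! ### The covering of germs of primitives -/

section EtaleSpace

variable {M : Type*} [TopologicalSpace M] [ChartedSpace ℂ M] [IsManifold 𝓘(ℂ, ℂ) ω M]
  {V : Type*} [NormedAddCommGroup V] [NormedSpace ℝ V] {η : RealForm M V}

/-- A vector space with the discrete topology. -/
def DiscreteFiber (V : Type*) : Type _ := V

instance (V : Type*) : TopologicalSpace (DiscreteFiber V) := ⊥

instance (V : Type*) : DiscreteTopology (DiscreteFiber V) := ⟨rfl⟩

/-- The bundle of germs of primitives of a locally exact one-form. -/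
def IsLocallyExact.bundleCore (h : IsLocallyExact η) : FiberBundleCore M M (DiscreteFiber V) where
  baseSet p := (h p).choose
  isOpen_baseSet p := (h p).choose_spec.choose_spec.1
  indexAt := id
  mem_baseSet_at p := (h p).choose_spec.choose_spec.2.1
  -- In the trivialization `i`, with chosen primitive `f_i`, the vector `v` stands for the germ of
  -- `f_i + v`, which equals `f_j + (v + f_i x - f_j x)`.
  coordChange i j x v :=
    show V from (show V from v) + ((h i).choose_spec.choose x - (h j).choose_spec.choose x)
  coordChange_self i x _ v := by
    change (show V from v) + _ = _
    rw [sub_self]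
    exact add_zero (show V from v)
  coordChange_comp i j k x _ v := by
    change ((show V from v) + _ + _ : V) = (show V from v) + _
    abel
  continuousOn_coordChange i j := by
    rintro ⟨x, v⟩ ⟨hx, -⟩
    have hi := (h i).choose_spec.choose_spec
    have hj := (h j).choose_spec.choose_spec
    have hev := IsPrimitiveOn.eventually_eq_add (hi.1.inter hj.1)
      (hi.2.2.mono Set.inter_subset_left) (hj.2.2.mono Set.inter_subset_right) hx
    refine ContinuousAt.continuousWithinAt ?_
    refine (continuousAt_const (y := (show DiscreteFiber V from (show V from v) +
      ((h i).choose_spec.choose x - (h j).choose_spec.choose x)))).congr ?_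
    have h1 : ∀ᶠ y : M × DiscreteFiber V in 𝓝 (x, v), y.2 = v :=
      (continuous_snd (X := M) (Y := DiscreteFiber V)).continuousAt (x := (x, v))
        ((isOpen_discrete {v}).mem_nhds (Set.mem_singleton v))
    have h2 := (continuous_fst (X := M) (Y := DiscreteFiber V)).continuousAt (x := (x, v)) hev
    filter_upwards [h1, h2] with y hy1 hy2
    change _ = (show V from y.2) + ((h i).choose_spec.choose y.1 - (h j).choose_spec.choose y.1)
    rw [hy1, hy2]

end EtaleSpace

/-- The étale space of primitives of a locally exact one-form: a covering with a developing map
that separates and exhausts the fibers. -/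
theorem IsLocallyExact.exists_isCoveringMap {M : Type u} [TopologicalSpace M] [ChartedSpace ℂ M]
    [IsManifold 𝓘(ℂ, ℂ) ω M] {V : Type v} [NormedAddCommGroup V] [NormedSpace ℝ V]
    {η : RealForm M V} (h : IsLocallyExact η) :
    ∃ (E : Type (max u v)) (_ : TopologicalSpace E) (π : C(E, M)) (φ : E → V),
      IsCoveringMap π ∧ IsDeveloping η π φ ∧ Function.Bijective fun e => (π e, φ e) := by
  let Z := h.bundleCore
  -- The value at `x` of the germ of `f_x + v`.
  let φ : Z.TotalSpace → V := fun e =>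
    (show V from e.2) + (h e.1).choose_spec.choose e.1
  refine ⟨Z.TotalSpace, inferInstance, ⟨Z.proj, Z.continuous_proj⟩, φ,
    FiberBundle.isCoveringMap (F := DiscreteFiber V) (E := Z.Fiber), ?_, ?_, ?_⟩
  · rintro ⟨x, v⟩
    have hx := (h x).choose_spec.choose_spec
    refine ⟨(h x).choose, fun q => (h x).choose_spec.choose q + (show V from v), hx.1, hx.2.1,
      hx.2.2.add_const _, ?_⟩
    have hcont : ContinuousAt (Z.localTriv x) (⟨x, v⟩ : Z.TotalSpace) :=
      (Z.localTriv x).continuousAt ((Z.mem_localTriv_source x _).2 hx.2.1)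
    have h1 : ∀ᶠ e in 𝓝 (⟨x, v⟩ : Z.TotalSpace),
        (Z.localTriv x e).2 = (Z.localTriv x (⟨x, v⟩ : Z.TotalSpace)).2 :=
      (continuous_snd.continuousAt.comp hcont) ((isOpen_discrete {_}).mem_nhds (Set.mem_singleton _))
    filter_upwards [h1] with e he
    have he' : (show V from e.2) + ((h e.1).choose_spec.choose e.1 -
        (h x).choose_spec.choose e.1) = (show V from v) + ((h x).choose_spec.choose x -
        (h x).choose_spec.choose x) := he
    change (show V from e.2) + (h e.1).choose_spec.choose e.1 =
      (h x).choose_spec.choose e.1 + (show V from v)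
    rw [sub_self, add_zero] at he'
    rw [← he']
    abel
  · rintro ⟨x, v⟩ ⟨y, w⟩ hxy
    obtain ⟨h1, h2⟩ := Prod.ext_iff.1 hxy
    obtain rfl : x = y := h1
    have : v = w := add_right_cancel (b := (h x).choose_spec.choose x) (G := V) h2
    rw [this]
  · rintro ⟨x, v⟩
    refine ⟨⟨x, (show V from v - (h x).choose_spec.choose x)⟩, Prod.ext rfl ?_⟩
    exact sub_add_cancel (G := V) v _

/-! ### Piecewise smooth representatives of homotopy classes -/

section PiecewiseSmooth

open Set

variable {M : Type*} [TopologicalSpace M] [ChartedSpace ℂ M]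

theorem IsPiecewiseSmooth.of_contMDiffOn {p q : M} {γ : Path p q}
    (h : ContMDiffOn 𝓘(ℝ, ℝ) 𝓘(ℝ, ℂ) ∞ γ.extend (Icc 0 1)) : IsPiecewiseSmooth γ := by
  refine ⟨1, ![0, 1], ?_, rfl, rfl, fun i => ?_⟩
  · intro i j hij
    fin_cases i <;> fin_cases j <;> simp_all
  · fin_cases i
    simpa using h

theorem IsPiecewiseSmooth.cast {p q p' q' : M} {γ : Path p q} (h : IsPiecewiseSmooth γ)
    (hp : p' = p) (hq : q' = q) : IsPiecewiseSmooth (γ.cast hp hq) := by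
  subst hp hq
  exact h

theorem IsPiecewiseSmooth.trans_contMDiffOn {p q r : M} {γ : Path p q} {σ : Path q r}
    (hγ : IsPiecewiseSmooth γ) (hσ : ContMDiffOn 𝓘(ℝ, ℝ) 𝓘(ℝ, ℂ) ∞ σ.extend (Icc 0 1)) :
    IsPiecewiseSmooth (γ.trans σ) := by
  obtain ⟨n, t, ht, h0, h1, h⟩ := hγ
  have hle : ∀ i, t i ≤ 1 := fun i => h1 ▸ ht.monotone (Fin.le_last i)
  -- The break points of `γ` are halved, the last one becoming `1/2`, and the end point `1` is
  -- appended.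
  refine ⟨n + 1, Fin.snoc (fun i => t i / 2) 1, ?_, ?_, ?_, ?_⟩
  · intro i j hij
    induction j using Fin.lastCases with
    | last =>
      induction i using Fin.lastCases with
      | last => exact absurd hij (lt_irrefl _)
      | cast i =>
        simp only [Fin.snoc_castSucc, Fin.snoc_last]
        linarith [hle i]
    | cast j =>
      induction i using Fin.lastCases with
      | last => exact absurd hij (not_lt.2 (Fin.le_last _))
      | cast i =>
        simp only [Fin.snoc_castSucc]
        linarith [ht (Fin.castSucc_lt_castSucc_iff.1 hij)]
  · rw [← Fin.castSucc_zero, Fin.snoc_castSucc, h0, zero_div]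
  · rw [Fin.snoc_last]
  · intro i
    induction i using Fin.lastCases with
    | last =>
      rw [Fin.succ_last, Fin.snoc_last, Fin.snoc_castSucc, h1]
      have haff : ContMDiff 𝓘(ℝ, ℝ) 𝓘(ℝ, ℝ) ∞ fun s : ℝ => 2 * s - 1 :=
        (by fun_prop : ContDiff ℝ ∞ fun s : ℝ => 2 * s - 1).contMDiff
      refine (hσ.comp haff.contMDiffOn ?_).congr ?_
      · intro s hs
        constructor <;> linarith [hs.1, hs.2]
      · intro s hs
        exact Path.extend_trans_of_half_le γ σ hs.1
    | cast i =>
      rw [Fin.succ_castSucc, Fin.snoc_castSucc, Fin.snoc_castSucc]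
      have haff : ContMDiff 𝓘(ℝ, ℝ) 𝓘(ℝ, ℝ) ∞ fun s : ℝ => 2 * s :=
        (by fun_prop : ContDiff ℝ ∞ fun s : ℝ => 2 * s).contMDiff
      refine ((h i).comp haff.contMDiffOn ?_).congr ?_
      · intro s hs
        constructor <;> linarith [hs.1, hs.2]
      · intro s hs
        refine Path.extend_trans_of_le_half γ σ ?_
        linarith [hs.2, hle i.succ]

variable [IsManifold 𝓘(ℂ, ℂ) ω M]

/-- A path in a coordinate disc is homotopic to a smooth path. -/
theorem exists_contMDiffOn_homotopic_of_ball {x p q : M} {r : ℝ}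
    (hr : Metric.ball (chartAt ℂ x x) r ⊆ (chartAt ℂ x).target) (γ : Path p q)
    (hγ : range γ ⊆ (chartAt ℂ x).source ∩ chartAt ℂ x ⁻¹' Metric.ball (chartAt ℂ x x) r) :
    ∃ σ : Path p q, ContMDiffOn 𝓘(ℝ, ℝ) 𝓘(ℝ, ℂ) ∞ σ.extend (Icc 0 1) ∧ γ.Homotopic σ := by
  set c := chartAt ℂ x with hc
  set B := Metric.ball (c x) r with hB
  have hγm : ∀ t, γ t ∈ c.source ∩ c ⁻¹' B := fun t => hγ (mem_range_self t)
  have hp : p ∈ c.source ∩ c ⁻¹' B := by simpa using hγm 0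
  have hq : q ∈ c.source ∩ c ⁻¹' B := by simpa using hγm 1
  have hBc : Convex ℝ B := convex_ball _ _
  -- A disc is simply connected, so the path is homotopic in it to the straight segment `σ'`; the
  -- inverse chart carries this to `M`.
  have : ContractibleSpace B := hBc.contractibleSpace ⟨_, hp.2⟩
  let ι : C(B, M) := ⟨fun z => c.symm z,
    continuousOn_iff_continuous_domRestrict.1 (c.continuousOn_symm.mono hr)⟩
  let γ' : Path (⟨c p, hp.2⟩ : B) ⟨c q, hq.2⟩ :=
    { toFun := fun t => ⟨c (γ t), (hγm t).2⟩
      continuous_toFun := (c.continuousOn.comp_continuous γ.continuous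
        fun t => (hγm t).1).subtype_mk _
      source' := by simp
      target' := by simp }
  let l (t : ℝ) : ℂ := AffineMap.lineMap (c p) (c q) t
  have hl : ∀ t ∈ Icc (0 : ℝ) 1, l t ∈ B := fun t ht => hBc.lineMap_mem hp.2 hq.2 ht
  have hlc : ContDiff ℝ ∞ l := by
    simp only [l, AffineMap.lineMap_apply_module]
    fun_prop
  let σ' : Path (⟨c p, hp.2⟩ : B) ⟨c q, hq.2⟩ :=
    { toFun := fun t => ⟨l t, hl t t.2⟩
      continuous_toFun := (hlc.continuous.comp continuous_subtype_val).subtype_mk _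
      source' := by simp [l]
      target' := by simp [l] }
  have hιp : p = ι ⟨c p, hp.2⟩ := (c.left_inv hp.1).symm
  have hιq : q = ι ⟨c q, hq.2⟩ := (c.left_inv hq.1).symm
  refine ⟨(σ'.map ι.continuous).cast hιp hιq, ?_, ?_⟩
  · have h1 : ContMDiffOn 𝓘(ℝ, ℂ) 𝓘(ℝ, ℂ) ∞ c.symm c.target := fun z hz =>
      (ContMDiffWithinAt.restrictScalars_real (contMDiffOn_chart_symm (x := x) z hz)).of_le le_top
    refine (h1.comp hlc.contMDiff.contMDiffOn fun t ht => hr (hl t ht)).congr fun t ht => ?_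
    rw [Path.extend_apply _ ht]
    rfl
  · have h1 : γ = (γ'.map ι.continuous).cast hιp hιq := by
      ext t
      exact (c.left_inv (hγm t).1).symm
    rw [h1]
    exact ⟨((SimplyConnectedSpace.paths_homotopic γ' σ').map ι).some.cast (by rfl) (by rfl)⟩

/-- Every path is homotopic to a piecewise smooth path. -/
theorem exists_isPiecewiseSmooth_homotopic {p q : M} (γ : Path p q) :
    ∃ σ : Path p q, IsPiecewiseSmooth σ ∧ γ.Homotopic σ := by
  have hball : ∀ x : M, ∃ r > 0, Metric.ball (chartAt ℂ x x) r ⊆ (chartAt ℂ x).target := fun x =>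
    Metric.isOpen_iff.1 (chartAt ℂ x).open_target _
      ((chartAt ℂ x).map_source (mem_chart_source ℂ x))
  choose r hr0 hr using hball
  let U (x : M) : Set M :=
    (chartAt ℂ x).source ∩ chartAt ℂ x ⁻¹' Metric.ball (chartAt ℂ x x) (r x)
  have hU : ∀ x, IsOpen (U x) := fun x => (chartAt ℂ x).isOpen_inter_preimage Metric.isOpen_ball
  have hxU : ∀ x, x ∈ U x := fun x => ⟨mem_chart_source ℂ x, Metric.mem_ball_self (hr0 x)⟩
  obtain ⟨t, t0, tmono, ⟨N, hN⟩, hsub⟩ := exists_monotone_Icc_subset_open_cover_unitInterval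
    (fun x => (hU x).preimage γ.continuous) fun s _ => mem_iUnion.2 ⟨γ s, hxU _⟩
  -- Each piece of the subdivision lies in one coordinate disc and is replaced there by a smooth
  -- path.
  have key : ∀ n, ∃ σ : Path (γ 0) (γ (t n)), IsPiecewiseSmooth σ ∧
      (γ.subpath 0 (t n)).Homotopic σ := by
    intro n
    induction n with
    | zero =>
      rw [t0]
      refine ⟨Path.refl _, .of_contMDiffOn ?_, ?_⟩
      · rw [Path.refl_extend]
        exact contMDiffOn_const
      · rw [Path.subpath_self]
    | succ n ih =>
      obtain ⟨σ, hσ, hσh⟩ := ih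
      obtain ⟨x, hx⟩ := hsub n
      obtain ⟨τ, hτ, hτh⟩ := exists_contMDiffOn_homotopic_of_ball (hr x)
        (γ.subpath (t n) (t (n + 1))) (by
          rw [Path.range_subpath_of_le _ _ _ (tmono n.le_succ)]
          exact image_subset_iff.2 hx)
      exact ⟨σ.trans τ, hσ.trans_contMDiffOn hτ,
        (Path.Homotopic.symm ⟨Path.Homotopy.subpathTransSubpath γ _ _ _⟩).trans (hσh.hcomp hτh)⟩
  obtain ⟨σ, hσ, hσh⟩ := key N
  have h1 : t N = 1 := hN N le_rfl
  have hq : γ (t N) = q := by rw [h1, γ.target]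
  refine ⟨σ.cast γ.source.symm hq.symm, hσ.cast _ _, ?_⟩
  have h2 : γ = (γ.subpath 0 (t N)).cast γ.source.symm hq.symm := by
    ext s
    simp [Path.subpath, h1]
  have h3 : ((γ.subpath 0 (t N)).cast γ.source.symm hq.symm).Homotopic
      (σ.cast γ.source.symm hq.symm) := ⟨hσh.some.cast rfl rfl⟩
  rwa [← h2] at h3

end PiecewiseSmooth

/-! ### Line integrals as increments of developing maps -/

section LineIntegral

open Set

variable {M : Type*} [TopologicalSpace M] [ChartedSpace ℂ M]
  {V : Type*} [NormedAddCommGroup V] [NormedSpace ℝ V]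
  {E : Type*} [TopologicalSpace E]

/-- At a break point of a path the two-sided derivative may not exist, so `g'` is constrained only
in the interior; the end points have measure zero. -/
theorem intervalIntegral_eq_sub_of_contDiffOn_of_hasDerivAt [CompleteSpace V] {g g' : ℝ → V}
    {a b : ℝ} (hab : a < b) (hg : ContDiffOn ℝ 1 g (Icc a b))
    (hg' : ∀ t ∈ Ioo a b, HasDerivAt g (g' t) t) :
    IntervalIntegrable g' MeasureTheory.volume a b ∧ ∫ t in a..b, g' t = g b - g a := by
  have hd : ContinuousOn (derivWithin g (Icc a b)) (Icc a b) :=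
    hg.continuousOn_derivWithin (uniqueDiffOn_Icc hab) le_rfl
  have hi : IntervalIntegrable (derivWithin g (Icc a b)) MeasureTheory.volume a b :=
    hd.intervalIntegrable_of_Icc hab.le
  have hae : derivWithin g (Icc a b) =ᵐ[MeasureTheory.volume.restrict (uIoc a b)] g' := by
    rw [uIoc_of_le hab.le, ← MeasureTheory.restrict_Ioo_eq_restrict_Ioc]
    filter_upwards [MeasureTheory.self_mem_ae_restrict measurableSet_Ioo] with t ht
    rw [derivWithin_of_mem_nhds (Icc_mem_nhds ht.1 ht.2), (hg' t ht).deriv]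
  refine ⟨hi.congr_ae hae, ?_⟩
  rw [← intervalIntegral.integral_derivWithin_Icc_of_contDiffOn_Icc hg hab.le]
  exact (intervalIntegral.integral_congr_ae_restrict hae).symm

/-- The integral of a one-form along a piecewise smooth path is the increment of a developing map
along a lift of the path. -/
theorem IsDeveloping.sub_eq_lineIntegral [CompleteSpace V] {η : RealForm M V} {π : E → M}
    {φ : E → V} (hφ : IsDeveloping η π φ) {p q : M} {γ : Path p q} (hγ : IsPiecewiseSmooth γ)
    (Γ : C(unitInterval, E)) (hΓ : ∀ t, π (Γ t) = γ t) :
    φ (Γ 1) - φ (Γ 0) = lineIntegral η γ := by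
  let g : ℝ → V := fun t => φ (Γ (projIcc 0 1 zero_le_one t))
  have hloc : ∀ t, ∃ (U : Set M) (f : M → V), IsOpen U ∧ γ.extend t ∈ U ∧ IsPrimitiveOn η f U ∧
      g =ᶠ[𝓝 t] f ∘ γ.extend := by
    intro t
    obtain ⟨U, f, hU, he, hf, hev⟩ := hφ (Γ (projIcc 0 1 zero_le_one t))
    refine ⟨U, f, hU, ?_, hf, ?_⟩
    · rw [hΓ] at he
      exact he
    · have hc : Continuous fun t => Γ (projIcc 0 1 zero_le_one t) :=
        Γ.continuous.comp continuous_projIcc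
      filter_upwards [hc.continuousAt hev] with s hs
      refine (show g s = _ from hs).trans ?_
      rw [hΓ]
      rfl
  obtain ⟨n, t, ht, h0, h1, h⟩ := hγ
  let g' : ℝ → V := fun s => η (γ.extend s) (mfderiv 𝓘(ℝ, ℝ) 𝓘(ℝ, ℂ) γ.extend s (1 : ℝ))
  have hpiece : ∀ i : Fin n, IntervalIntegrable g' MeasureTheory.volume (t i.castSucc) (t i.succ) ∧
      ∫ s in (t i.castSucc)..(t i.succ), g' s = g (t i.succ) - g (t i.castSucc) := by
    intro i
    have hlt : t i.castSucc < t i.succ := ht Fin.castSucc_lt_succ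
    refine intervalIntegral_eq_sub_of_contDiffOn_of_hasDerivAt hlt ?_ ?_
    · intro s hs
      obtain ⟨U, f, hU, he, hf, hev⟩ := hloc s
      have h2 := ((hf.1 _ he).contMDiffAt (hU.mem_nhds he)).comp_contMDiffWithinAt s (h i s hs)
      have h3 := contMDiffWithinAt_iff_contDiffWithinAt.1
        (h2.congr_of_eventuallyEq (hev.filter_mono nhdsWithin_le_nhds) hev.eq_of_nhds)
      exact h3.of_le (by exact_mod_cast le_top)
    · intro s hs
      obtain ⟨U, f, hU, he, hf, hev⟩ := hloc s
      have h2 := ((h i s (Ioo_subset_Icc_self hs)).contMDiffAt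
        (Icc_mem_nhds hs.1 hs.2)).mdifferentiableAt (by simp)
      have h3 := ((hf.2 _ he).comp s h2.hasMFDerivAt).congr_of_eventuallyEq hev
      have h4 : HasFDerivAt g ((show ℂ →L[ℝ] V from η (γ.extend s)).comp
        (show ℝ →L[ℝ] ℂ from mfderiv 𝓘(ℝ, ℝ) 𝓘(ℝ, ℂ) γ.extend s)) s := h3.hasFDerivAt
      exact h4.hasDerivAt
  have hsum : ∀ i : Fin (n + 1), IntervalIntegrable g' MeasureTheory.volume 0 (t i) ∧
      ∫ s in (0 : ℝ)..(t i), g' s = g (t i) - g 0 := by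
    intro i
    induction i using Fin.induction with
    | zero =>
      rw [h0]
      simp
    | succ i ih =>
      refine ⟨ih.1.trans (hpiece i).1, ?_⟩
      rw [← intervalIntegral.integral_add_adjacent_intervals ih.1 (hpiece i).1, ih.2,
        (hpiece i).2]
      abel
  have h2 := (hsum (Fin.last n)).2
  rw [h1] at h2
  rw [lineIntegral, h2]
  simp [g]

end LineIntegral

/-! ### Existence and monodromy of the period covering -/

section PeriodCovering

/-- If the projection of a path is homotopic to `σ`, then `σ` lifts to a path with the same
end points. -/
theorem IsCoveringMap.exists_map_eq_of_homotopic {E X : Type*} [TopologicalSpace E]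
    [TopologicalSpace X] {π : C(E, X)} (cov : IsCoveringMap π) {e e' : E} (δ : Path e e')
    {σ : Path (π e) (π e')} (h : (δ.map π.continuous).Homotopic σ) :
    ∃ τ : Path e e', τ.map π.continuous = σ := by
  have h1 := cov.liftPath_apply_one_eq_of_homotopicRel h e (by simp) (by simp)
  have h2 : δ.toContinuousMap = cov.liftPath (δ.map π.continuous).toContinuousMap e (by simp) :=
    (cov.eq_liftPath_iff' _).2 ⟨rfl, δ.source⟩
  refine ⟨⟨cov.liftPath σ.toContinuousMap e (by simp), cov.liftPath_zero _ _ _, ?_⟩, ?_⟩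
  · refine h1.symm.trans ?_
    rw [← h2]
    exact δ.target
  · ext t
    exact congrFun (cov.liftPath_lifts σ.toContinuousMap e (by simp)) t

theorem IsCoveringMap.surjective_of_pathConnectedSpace {E X : Type*} [TopologicalSpace E]
    [TopologicalSpace X] [Nonempty E] [PathConnectedSpace X] {π : E → X} (cov : IsCoveringMap π) :
    Function.Surjective π := by
  intro x
  obtain ⟨e⟩ := ‹Nonempty E›
  let γ : Path (π e) x := PathConnectedSpace.somePath _ _
  obtain ⟨Γ, hΓ, -⟩ := cov.exists_path_lifts γ.toContinuousMap e (by simp)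
  exact ⟨Γ 1, (congrFun hΓ 1).trans γ.target⟩

theorem IsPeriodCovering.pathConnectedSpace {M V E : Type*} [TopologicalSpace M] [ChartedSpace ℂ M]
    [NormedAddCommGroup V] [NormedSpace ℝ V] {η : RealForm M V} [TopologicalSpace E]
    [ChartedSpace ℂ E] {π : C(E, M)} (hπ : IsPeriodCovering η π) :
    PathConnectedSpace E := by
  have := hπ.connected
  have : LocallyPathConnectedSpace E := ChartedSpace.locallyPathConnectedSpace ℂ E
  exact pathConnectedSpace_iff_connectedSpace.2 inferInstance

variable {M : Type*} [TopologicalSpace M] [ChartedSpace ℂ M] [IsManifold 𝓘(ℂ, ℂ) ω M]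
  {V : Type*} [NormedAddCommGroup V] [NormedSpace ℝ V] [CompleteSpace V] {η : RealForm M V}

/-- A class lies in the image of `π_*` when a representative lifts to a loop at `e`. The lift
changes `φ` by the period, and by `hinj` it closes up exactly when `φ` returns to its initial value.
-/
theorem IsDeveloping.range_map_eq_periodKernel {E : Type*} [TopologicalSpace E] {π : C(E, M)}
    (cov : IsCoveringMap π) {φ : E → V} (hφ : IsDeveloping η π φ) (e : E)
    (hinj : ∀ e', π e' = π e → φ e' = φ e → e' = e) :
    ((FundamentalGroup.map π e).range : Set (FundamentalGroup M (π e))) =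
      periodKernel η (π e) := by
  ext g
  constructor
  · rintro ⟨d, rfl⟩
    obtain ⟨δ, rfl⟩ := Path.Homotopic.Quotient.mk_surjective d
    obtain ⟨γ, hγ, hδγ⟩ := exists_isPiecewiseSmooth_homotopic (δ.map π.continuous)
    obtain ⟨τ, rfl⟩ := cov.exists_map_eq_of_homotopic δ hδγ
    refine ⟨_, hγ, (Path.Homotopic.Quotient.eq.2 hδγ).symm, ?_⟩
    rw [← hφ.sub_eq_lineIntegral hγ τ.toContinuousMap fun t => rfl]
    simp
  · rintro ⟨γ, hγ, rfl, h0⟩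
    obtain ⟨Γ, hΓ, hΓ0⟩ := cov.exists_path_lifts γ.toContinuousMap e (by simp)
    rw [← hφ.sub_eq_lineIntegral hγ Γ (congrFun hΓ), hΓ0, sub_eq_zero] at h0
    have h1 : Γ 1 = e := hinj _ ((congrFun hΓ 1).trans γ.target) h0
    refine ⟨FundamentalGroup.fromPath (.mk ⟨Γ, hΓ0, h1⟩), ?_⟩
    refine congrArg Path.Homotopic.Quotient.mk (?_ : Path.map _ _ = γ)
    ext t
    exact congrFun hΓ t

/-- The covering of a locally exact one-form exists. -/
theorem IsLocallyExact.exists_isPeriodCovering {M : Type u} [TopologicalSpace M] [ChartedSpace ℂ M]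
    [IsManifold 𝓘(ℂ, ℂ) ω M] [T2Space M] [Nonempty M] {V : Type v} [NormedAddCommGroup V]
    [NormedSpace ℝ V] [CompleteSpace V] {η : RealForm M V} (h : IsLocallyExact η) :
    ∃ (E : Type (max u v)) (_ : TopologicalSpace E) (_ : ChartedSpace ℂ E) (π : C(E, M)),
      T2Space E ∧ IsManifold 𝓘(ℂ, ℂ) ω E ∧ IsPeriodCovering η π := by
  obtain ⟨E, _, π, φ, cov, hφ, hbij⟩ := h.exists_isCoveringMap
  obtain ⟨p⟩ := ‹Nonempty M›
  obtain ⟨e₀, -⟩ := hbij.2 (p, 0)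
  have : LocallyConnectedSpace M := ChartedSpace.locallyConnectedSpace ℂ M
  have : LocallyConnectedSpace E :=
    let _ := cov.isLocalHomeomorph.pullbackChartedSpace (H := ℂ)
    ChartedSpace.locallyConnectedSpace ℂ E
  let C := connectedComponent e₀
  have cov' := cov.restrict_isClopen (C := C) isClopen_connectedComponent
  have hloc := cov'.isLocalHomeomorph
  refine ⟨C, inferInstance, hloc.pullbackChartedSpace, π.comp ⟨Subtype.val, continuous_subtype_val⟩,
    -- Points of one fiber are separated by the covering, all others by their images in `M`.
    ⟨fun x y hxy => ?_⟩, hloc.isManifold_pullback, ?_⟩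
  · by_cases hπ : π x = π y
    · exact cov'.isSeparatedMap x y hπ hxy
    · obtain ⟨s, t, hs, ht, hxs, hyt, hst⟩ := t2_separation hπ
      exact ⟨_, _, hs.preimage cov'.continuous, ht.preimage cov'.continuous, hxs, hyt,
        hst.preimage _⟩
  · let _ := hloc.pullbackChartedSpace (H := ℂ)
    refine ⟨Subtype.connectedSpace isConnected_connectedComponent, cov',
      hloc.isLocalDiffeomorph_pullback, fun e => ?_⟩
    have hval : Continuous (Subtype.val : C → E) := continuous_subtype_val
    have hφ' : IsDeveloping η (fun e : C => π e) (fun e : C => φ e) := hφ.comp hval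
    exact IsDeveloping.range_map_eq_periodKernel
      (π := π.comp ⟨Subtype.val, continuous_subtype_val⟩) cov' hφ' e
      fun e' h1 h2 => Subtype.ext (hbij.1 (Prod.ext h1 h2))

variable {E : Type*} [TopologicalSpace E] [ChartedSpace ℂ E] {π : C(E, M)}

/-- On the covering of a locally exact one-form there is a developing map. -/
theorem IsPeriodCovering.exists_isDeveloping (hπ : IsPeriodCovering η π) (h : IsLocallyExact η) :
    ∃ φ : E → V, IsDeveloping η π φ := by
  obtain ⟨E', _, π', φ, cov, hφ, hbij⟩ := h.exists_isCoveringMap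
  have := hπ.pathConnectedSpace
  have : LocallyPathConnectedSpace E := ChartedSpace.locallyPathConnectedSpace ℂ E
  obtain ⟨e₀⟩ : Nonempty E := inferInstance
  obtain ⟨e₀', he⟩ := hbij.2 (π e₀, 0)
  have he' : π' e₀' = π e₀ := congrArg Prod.fst he
  -- Lifting criterion: loops in the image of `π_*` have period zero, hence lift to loops in the
  -- germ space, where `φ` separates the points of a fiber.
  obtain ⟨F, ⟨-, hF⟩, -⟩ := cov.existsUnique_continuousMap_lifts_of_range_le (f := π) he' (by
    intro g hg
    have hg' : g ∈ periodKernel η (π e₀) := hπ.range_map e₀ ▸ hg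
    obtain ⟨γ, hγ, rfl, h0⟩ := hg'
    obtain ⟨Γ, hΓ, hΓ0⟩ := cov.exists_path_lifts γ.toContinuousMap e₀' (by simp [he'])
    rw [← hφ.sub_eq_lineIntegral hγ Γ (congrFun hΓ), hΓ0, sub_eq_zero] at h0
    have h1 : Γ 1 = e₀' :=
      hbij.1 (Prod.ext ((congrFun hΓ 1).trans (γ.target.trans he'.symm)) h0)
    refine ⟨FundamentalGroup.fromPath (.mk ⟨Γ, hΓ0, h1⟩), ?_⟩
    rw [FundamentalGroup.mapOfEq_apply, ← Path.Homotopic.Quotient.mk_map,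
      ← Path.Homotopic.Quotient.mk_cast]
    refine congrArg Path.Homotopic.Quotient.mk (?_ : Path.cast _ _ _ = γ)
    ext t
    exact congrFun hΓ t)
  exact ⟨φ ∘ F, hF ▸ hφ.comp F.continuous⟩

/-- The covering of a locally exact one-form is bijective if and only if all periods vanish. -/
theorem IsPeriodCovering.bijective_iff [ConnectedSpace M] (hπ : IsPeriodCovering η π)
    (h : IsLocallyExact η) : Function.Bijective π ↔ ∀ c ∈ periods η, c = 0 := by
  have := hπ.pathConnectedSpace
  have cov := hπ.covering
  constructor
  · rintro hbij _ ⟨p, γ, hγ, rfl⟩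
    obtain ⟨φ, hφ⟩ := hπ.exists_isDeveloping h
    obtain ⟨e, rfl⟩ := hbij.2 p
    obtain ⟨Γ, hΓ, hΓ0⟩ := cov.exists_path_lifts γ.toContinuousMap e (by simp)
    have h1 : Γ 1 = e := hbij.1 ((congrFun hΓ 1).trans γ.target)
    rw [← hφ.sub_eq_lineIntegral hγ Γ (congrFun hΓ), hΓ0, h1, sub_self]
  · intro h0
    have : LocallyPathConnectedSpace M := ChartedSpace.locallyPathConnectedSpace ℂ M
    have : PathConnectedSpace M := pathConnectedSpace_iff_connectedSpace.2 inferInstance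
    refine ⟨fun e e' hee => ?_, cov.surjective_of_pathConnectedSpace⟩
    -- Its projection is a loop without period, hence homotopic to the projection of a loop `δ'` at
    -- `e`. Lifts of homotopic paths from `e` have the same end point, so `e' = e`.
    let δ : Path e e' := PathConnectedSpace.somePath e e'
    obtain ⟨γ, hγ, hδγ⟩ :=
      exists_isPiecewiseSmooth_homotopic ((δ.map π.continuous).cast rfl hee)
    have hmem : (Path.Homotopic.Quotient.mk γ : FundamentalGroup M (π e)) ∈
        periodKernel η (π e) := ⟨γ, hγ, rfl, h0 _ ⟨_, γ, hγ, rfl⟩⟩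
    rw [← hπ.range_map e] at hmem
    obtain ⟨d, hd⟩ := hmem
    obtain ⟨δ', rfl⟩ := Path.Homotopic.Quotient.mk_surjective d
    have h1 : (δ'.map π.continuous).Homotopic γ := Path.Homotopic.Quotient.eq.1 hd
    have h2 := cov.liftPath_apply_one_eq_of_homotopicRel (h1.trans hδγ.symm) e (by simp) (by simp)
    have h3 : δ.toContinuousMap = cov.liftPath
        ((δ.map π.continuous).cast rfl hee).toContinuousMap e (by simp) :=
      (cov.eq_liftPath_iff' _).2 ⟨rfl, δ.source⟩
    have h4 : δ'.toContinuousMap = cov.liftPath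
        (δ'.map π.continuous).toContinuousMap e (by simp) :=
      (cov.eq_liftPath_iff' _).2 ⟨rfl, δ'.source⟩
    rw [← h3, ← h4] at h2
    exact (δ'.target.symm.trans h2).trans δ.target

end PeriodCovering

/-! ### Assembling the theorem -/

section Main

variable {M : Type*} [TopologicalSpace M] [ChartedSpace ℂ M]

theorem IsPeriodCovering.exists_diffeomorph_iff {V : Type*} [NormedAddCommGroup V]
    [NormedSpace ℝ V] {η : RealForm M V} {E : Type*} [TopologicalSpace E] [ChartedSpace ℂ E]
    {π : C(E, M)} (hπ : IsPeriodCovering η π) :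
    (∃ Φ : Diffeomorph 𝓘(ℂ, ℂ) 𝓘(ℂ, ℂ) E M ω, ⇑Φ = π) ↔ Function.Bijective π :=
  ⟨fun ⟨Φ, hΦ⟩ => hΦ ▸ Φ.bijective, fun h =>
    ⟨hπ.localBiholomorphism.diffeomorphOfBijective h, rfl⟩⟩

theorem IsDeveloping.isPrimitiveOn {V : Type*} [NormedAddCommGroup V] [NormedSpace ℝ V]
    {η : RealForm M V} {φ : M → V} (h : IsDeveloping η id φ) : IsPrimitiveOn η φ Set.univ := by
  refine ⟨fun p _ => ?_, fun p _ => ?_⟩ <;> obtain ⟨U, f, hU, hp, hf, hev⟩ := h p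
  · exact (((hf.1 _ hp).contMDiffAt (hU.mem_nhds hp)).congr_of_eventuallyEq hev).contMDiffWithinAt
  · exact (hf.2 _ hp).congr_of_eventuallyEq hev

variable [IsManifold 𝓘(ℂ, ℂ) ω M]

/-- Two primitives of the same one-form on a connected surface differ by a constant. -/
theorem IsPrimitiveOn.exists_eq_add_const [ConnectedSpace M] {V : Type*} [NormedAddCommGroup V]
    [NormedSpace ℝ V] {η : RealForm M V} {φ ψ : M → V} (hφ : IsPrimitiveOn η φ Set.univ)
    (hψ : IsPrimitiveOn η ψ Set.univ) : ∃ c, ∀ p, ψ p = φ p + c := by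
  have hlc : IsLocallyConstant fun p => ψ p - φ p :=
    (IsLocallyConstant.iff_eventually_eq _).2 fun p =>
      IsPrimitiveOn.eventually_eq_add isOpen_univ hψ hφ (Set.mem_univ p)
  obtain ⟨p₀⟩ : Nonempty M := inferInstance
  refine ⟨ψ p₀ - φ p₀, fun p => ?_⟩
  rw [← hlc.apply_eq_of_preconnectedSpace p p₀]
  abel

/-- Both integrals are increments along the same lift, of a developing map `φ` and of `L ∘ φ`. -/
theorem IsLocallyExact.lineIntegral_clm_comp {V V' : Type*} [NormedAddCommGroup V]
    [NormedSpace ℝ V] [CompleteSpace V] [NormedAddCommGroup V'] [NormedSpace ℝ V'] [CompleteSpace V']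
    {η : RealForm M V} (h : IsLocallyExact η) (L : V →L[ℝ] V') {p q : M} {γ : Path p q}
    (hγ : IsPiecewiseSmooth γ) :
    lineIntegral (fun p => L.comp (η p)) γ = L (lineIntegral η γ) := by
  obtain ⟨E, _, π, φ, cov, hφ, hbij⟩ := h.exists_isCoveringMap
  obtain ⟨e, he⟩ := hbij.2 (p, 0)
  have hep : π e = p := congrArg Prod.fst he
  obtain ⟨Γ, hΓ, -⟩ := cov.exists_path_lifts γ.toContinuousMap e (by simp [hep])
  rw [← hφ.sub_eq_lineIntegral hγ Γ (congrFun hΓ),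
    ← (hφ.clm_comp L).sub_eq_lineIntegral hγ Γ (congrFun hΓ), map_sub]

theorem HolomorphicWeierstrassRep.hasImaginaryPeriods_iff (W : HolomorphicWeierstrassRep M) :
    HasImaginaryPeriods W.form ↔ ∀ c ∈ periods W.form.re, c = 0 := by
  have h := Form10.isLocallyExact_toReal W.holomorphic
  have key : ∀ {p q : M} {γ : Path p q}, IsPiecewiseSmooth γ →
      lineIntegral W.form.re γ = reC3 (lineIntegral W.form.toReal γ) :=
    fun hγ => h.lineIntegral_clm_comp reC3 hγ
  constructor
  · rintro h0 _ ⟨p, γ, hγ, rfl⟩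
    rw [key hγ]
    ext i
    exact h0 _ ⟨p, γ, hγ, rfl⟩ i
  · rintro h0 _ ⟨p, γ, hγ, rfl⟩ i
    have := h0 _ ⟨p, γ, hγ, rfl⟩
    rw [key hγ] at this
    exact congrArg (fun v : R3 => v i) this

/-- If all periods of a form vanish, its covering is the identity. -/
theorem isPeriodCovering_id [ConnectedSpace M] {V : Type*} [NormedAddCommGroup V]
    [NormedSpace ℝ V] {η : RealForm M V} (h : ∀ c ∈ periods η, c = 0) :
    IsPeriodCovering η (ContinuousMap.id M) where
  connected := inferInstance
  covering := by
    intro x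
    have : IsEvenlyCovered (ContinuousMap.id M) x PUnit.{1} :=
      ⟨inferInstance, Set.univ, trivial, isOpen_univ, isOpen_univ,
        (Homeomorph.prodPUnit _).symm, fun _ => rfl⟩
    exact this.to_isEvenlyCovered_preimage
  localBiholomorphism := (Diffeomorph.refl 𝓘(ℂ, ℂ) M ω).isLocalDiffeomorph
  range_map p := by
    ext g
    obtain ⟨δ, rfl⟩ := Path.Homotopic.Quotient.mk_surjective g
    refine ⟨fun _ => ?_, fun _ => ⟨FundamentalGroup.fromPath (.mk δ), rfl⟩⟩
    obtain ⟨γ, hγ, hδγ⟩ := exists_isPiecewiseSmooth_homotopic δ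
    exact ⟨γ, hγ, (Path.Homotopic.Quotient.eq.2 hδγ).symm, h _ ⟨_, γ, hγ, rfl⟩⟩

/-- An immersion of `M` is a global primitive, so loops have period zero; conversely the developing
map on the covering `id` is such a primitive. -/
theorem HolomorphicWeierstrassRep.exists_immersion_iff [ConnectedSpace M]
    (W : HolomorphicWeierstrassRep M) :
    (∃ φ : M → R3, IsConformalImmersion φ ∧ IsMinimal φ ∧ twoDel φ = W.form) ↔
      HasImaginaryPeriods W.form := by
  rw [W.hasImaginaryPeriods_iff]
  constructor
  · rintro ⟨φ, hφ, -, hW⟩ _ ⟨p, γ, hγ, rfl⟩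
    rw [← (hφ.isPrimitiveOn hW).isDeveloping_id.sub_eq_lineIntegral hγ γ.toContinuousMap
      fun t => rfl]
    simp
  · intro h0
    obtain ⟨φ, hφ⟩ := (isPeriodCovering_id h0).exists_isDeveloping
      (Form10.isLocallyExact_re W.holomorphic)
    have hφ' : IsPrimitiveOn W.form.re φ Set.univ := IsDeveloping.isPrimitiveOn hφ
    exact ⟨φ, hφ'.isConformalImmersion, hφ'.isMinimal, hφ'.twoDel_eq⟩

theorem HolomorphicWeierstrassRep.exists_immersion_of_isPeriodCovering
    (W : HolomorphicWeierstrassRep M) {E : Type*} [TopologicalSpace E] [ChartedSpace ℂ E]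
    [IsManifold 𝓘(ℂ, ℂ) ω E] {π : C(E, M)} (hπ : IsPeriodCovering W.form.re π) :
    ∃ φ : E → R3, IsConformalImmersion φ ∧ IsMinimal φ ∧ twoDel φ = W.form.pullback π := by
  obtain ⟨φ, hφ⟩ := hπ.exists_isDeveloping (Form10.isLocallyExact_re W.holomorphic)
  have h : IsPrimitiveOn (W.pullback hπ.localBiholomorphism).form.re φ Set.univ :=
    IsDeveloping.isPrimitiveOn_pullback hπ.localBiholomorphism hφ
  exact ⟨φ, h.isConformalImmersion, h.isMinimal, h.twoDel_eq⟩

end Main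

end

theorem mainTheorem9 {M : Type u} [TopologicalSpace M] [T2Space M] [ConnectedSpace M]
    [ChartedSpace ℂ M] [IsManifold 𝓘(ℂ, ℂ) ω M] (W : HolomorphicWeierstrassRep M) :
    (∃ (E : Type u) (_ : TopologicalSpace E) (_ : ChartedSpace ℂ E) (π : C(E, M)),
      T2Space E ∧ IsManifold 𝓘(ℂ, ℂ) ω E ∧ IsPeriodCovering W.form.re π) ∧
    (∀ (E : Type v) [TopologicalSpace E] [ChartedSpace ℂ E] [IsManifold 𝓘(ℂ, ℂ) ω E]
      (π : C(E, M)), IsPeriodCovering W.form.re π →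
      (∃ φ : E → R3, IsConformalImmersion φ ∧ IsMinimal φ ∧ twoDel φ = W.form.pullback π) ∧
      (∀ φ ψ : E → R3,
        IsConformalImmersion φ → IsMinimal φ → twoDel φ = W.form.pullback π →
        IsConformalImmersion ψ → IsMinimal ψ → twoDel ψ = W.form.pullback π →
        ∃ c : R3, ∀ e, ψ e = φ e + c) ∧
      ((∃ Φ : Diffeomorph 𝓘(ℂ, ℂ) 𝓘(ℂ, ℂ) E M ω, ⇑Φ = π) ↔ HasImaginaryPeriods W.form)) ∧
    ((∃ φ : M → R3, IsConformalImmersion φ ∧ IsMinimal φ ∧ twoDel φ = W.form) ↔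
      HasImaginaryPeriods W.form) := by
  have hexact := Form10.isLocallyExact_re W.holomorphic
  refine ⟨hexact.exists_isPeriodCovering, fun E _ _ _ π hπ => ⟨?_, ?_, ?_⟩,
    W.exists_immersion_iff⟩
  · exact W.exists_immersion_of_isPeriodCovering hπ
  · intro φ ψ hφ _ hφW hψ _ hψW
    have := hπ.connected
    exact (hφ.isPrimitiveOn hφW).exists_eq_add_const (hψ.isPrimitiveOn hψW)
  · rw [hπ.exists_diffeomorph_iff, hπ.bijective_iff hexact, W.hasImaginaryPeriods_iff]
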